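/- For $n\ge 1$ let $\mathcal T_n$ be the triangulation of a square with corners $\mathbf p,\mathbf q,\mathbf r,\mathbf s$ (in cyclic order) and $n$ interior vertices $v_1,\dots,v_n$ whose triangles, with their orientations, are, where $v_0=\mathbf p$ and $v_{n+1}=\mathbf r$, $$A_i=(\mathbf q,v_i,v_{i-1}),\qquad B_i=(\mathbf s,v_{i-1},v_i)\qquad(1\le i\le n+1).$$ A drawing of $\mathcal T_n$ is a map $\rho$ from its vertices to $\mathbb C^2$ with $\rho(\mathbf p)+\rho(\mathbf r)=\rho(\mathbf q)+\rho(\mathbf s)$. It is generic if it is injective, the parallelogram $\rho(\mathbf p)\rho(\mathbf q)\rho(\mathbf r)\rho(\mathbf s)$ is non-degenerate and all triangles have non-zero area, where the area of a triangle with vertices $(x_i,y_i)$, $i=1,2,3$, is $\frac12\det\begin{pmatrix}1&1&1\\x_1&x_2&x_3\\y_1&y_2&y_3\end{pmatrix}$. Let $X$ be the closure of the set of generic drawings. The area variety $V\subset\mathbb P^{2n+1}(\mathbb C)$ is the closure of the set of points $[\cdots:\mathrm{Area}(\Delta):\cdots]$, where $\Delta$ runs over the $2n+2$ triangles, that arise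 from the drawings in $X$ whose areas do not all vanish. An area polynomial of $\mathcal T_n$ is a homogeneous polynomial $p$ with integer coefficients without a common factor, in one variable for each triangle, which generates the ideal of the polynomials vanishing on $V$. Let $\sigma$ be the sum of all $2n+2$ variables. A Monsky polynomial of $\mathcal T_n$ is a homogeneous integer polynomial $f$, in the same variables, such that for some integer $e\ge0$ the relation $2f=\sigma^e$ holds identically when the areas of the triangles, as polynomials in the vertex coordinates subject only to $\mathbf p+\mathbf r=\mathbf q+\mathbf s$, are substituted for the variables. Proposition (the diagonal case has positive Monsky polynomial). For each $n\ge1$, a generic drawing of $\mathcal T_n$ exists and the area variety $V$ is a hypersurface; $\mathcal T_n$ has an area polynomial $p_n$, which is unique up to sign. Let $p$ be either of the two area polynomials and $d=\deg p$. Then $p$ is small: it is homogeneous and the absolute value of the coefficient of each monomial is at most the corresponding multinomial coefficient. The canonical Monsky polynomials $f=\frac12(\sigma^d+p)$ and $\tilde f=\frac12(\sigma^d-p)$ have integer coefficients, are Monsky polynomials of $\mathcal T_n$, and all of their coefficients are non-negative. -/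

import Mathlib

open scoped LinearAlgebra.Projectivization

/-- Signed area of the ordered triangle `(a, b, c)` in the affine plane over a field. -/
def triangleArea {F : Type*} [Field F] (a b c : F × F) : F :=
  1 / 2 * Matrix.det !![1, 1, 1; a.1, b.1, c.1; a.2, b.2, c.2]

/-- An honest triangulation of a square, as an oriented abstract simplicial complex with vertex
set `V` and triangles indexed by `ι`: a triangle is listed as `(tri j 0, tri j 1, tri j 2)` in its
cyclic orientation, and `corner 0, …, corner 3` are the four boundary vertices `𝐩, 𝐪, 𝐫, 𝐬` in
cyclic order. Since `edge_unique`, `boundary` and `connected` describe a strongly connected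
oriented pseudosurface whose boundary is the 4-cycle `𝐩𝐪𝐫𝐬`, and `euler` says that its Euler
characteristic `|V| - (3|ι| + 4)/2 + |ι|` is `1`, the complex is homeomorphic to a disk. -/
structure SquareTriangulation (V ι : Type) [Fintype V] [Fintype ι] where
  corner : Fin 4 ↪ V
  tri : ι → Fin 3 ↪ V
  /-- every vertex lies on a triangle -/
  covers : ∀ v, ∃ j a, tri j a = v
  /-- a directed edge belongs to at most one oriented triangle -/
  edge_unique : ∀ j k a b, tri j a = tri k b → tri j (a + 1) = tri k (b + 1) → j = k
  /-- the directed edges of triangles whose reverse is not an edge of a triangle are exactly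
  `𝐩𝐪`, `𝐪𝐫`, `𝐫𝐬`, `𝐬𝐩` -/
  boundary : ∀ u v,
    ((∃ j a, tri j a = u ∧ tri j (a + 1) = v) ∧ ¬ ∃ j a, tri j a = v ∧ tri j (a + 1) = u) ↔
      ∃ c, u = corner c ∧ v = corner (c + 1)
  /-- any two triangles are joined by a chain of triangles in which neighbours share an edge -/
  connected : ∀ j k, Relation.ReflTransGen
    (fun j k => ∃ a b, tri j a = tri k (b + 1) ∧ tri j (a + 1) = tri k b) j k
  euler : Fintype.card ι + 6 = 2 * Fintype.card V

namespace SquareTriangulation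

variable {V ι : Type} [Fintype V] [Fintype ι] (T : SquareTriangulation V ι)

/-! ### Drawings and the area variety -/

/-- The areas of the triangles of `T`, when its vertices are placed at the points `ρ v`. -/
def areas {F : Type*} [Field F] (ρ : V → F × F) (j : ι) : F :=
  triangleArea (ρ (T.tri j 0)) (ρ (T.tri j 1)) (ρ (T.tri j 2))

/-- A drawing: the corners go to the vertices of a (possibly degenerate) parallelogram. -/
def IsDrawing (ρ : V → ℂ × ℂ) : Prop :=
  ρ (T.corner 0) + ρ (T.corner 2) = ρ (T.corner 1) + ρ (T.corner 3)

/-- A generic drawing of an honest triangulation: the boundary parallelogram has no three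
consecutive collinear vertices, every triangle is non-degenerate, and `ρ` is injective. -/
structure IsGeneric (ρ : V → ℂ × ℂ) : Prop where
  isDrawing : T.IsDrawing ρ
  corners : ∀ c : Fin 4,
    triangleArea (ρ (T.corner c)) (ρ (T.corner (c + 1))) (ρ (T.corner (c + 2))) ≠ 0
  triangles : ∀ j, T.areas ρ j ≠ 0
  injective : Function.Injective ρ

/-- The deformation space `X(T)`: the closure of the set of generic drawings. -/
def drawingSpace : Set (V → ℂ × ℂ) :=
  closure {ρ | T.IsGeneric ρ}

/-- The image of `X(T)` under the rational map `ρ ↦ [⋯ : Area(T_j) : ⋯]`, which is defined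
where not all areas vanish. -/
def areaImage : Set (ℙ ℂ (ι → ℂ)) :=
  {x | ∃ ρ ∈ T.drawingSpace, ∃ h : T.areas ρ ≠ 0, x = Projectivization.mk ℂ (T.areas ρ) h}

/-- The area variety `V(T)`: the Zariski closure of the image of the area map, that is, the
common zeros of all homogeneous polynomials which vanish on this image. -/
def areaVariety : Set (ℙ ℂ (ι → ℂ)) :=
  {x | ∀ (d : ℕ) (F : MvPolynomial ι ℂ), F.IsHomogeneous d →
    (∀ y ∈ T.areaImage, MvPolynomial.eval y.rep F = 0) → MvPolynomial.eval x.rep F = 0}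

/-- `T` is hyper: it has a generic drawing, and `V(T)` is a hypersurface, i.e. the zero set of one
non-zero homogeneous polynomial of positive degree. -/
def IsHyper : Prop :=
  (∃ ρ, T.IsGeneric ρ) ∧
    ∃ (d : ℕ) (F : MvPolynomial ι ℂ), 0 < d ∧ F ≠ 0 ∧ F.IsHomogeneous d ∧
      T.areaVariety = {x | MvPolynomial.eval x.rep F = 0}

/-- `p` is an area polynomial of `T`: a homogeneous polynomial with integer coefficients without a
common factor, which generates the ideal of the polynomials vanishing on `V(T)`. -/
def IsAreaPolynomial (p : MvPolynomial ι ℤ) : Prop :=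
  (∃ d : ℕ, p.IsHomogeneous d) ∧
  (∀ c : ℤ, MvPolynomial.C c ∣ p → IsUnit c) ∧
  ∀ (d : ℕ) (F : MvPolynomial ι ℂ), F.IsHomogeneous d →
    ((∀ x ∈ T.areaVariety, MvPolynomial.eval x.rep F = 0) ↔
      MvPolynomial.map (Int.castRingHom ℂ) p ∣ F)

/-! ### Monsky polynomials -/

/-- The coordinate function field `ℚ(x_v, y_v)`, where `v` runs over all vertices other than `𝐫`;
the variables `(v, 0)` and `(v, 1)` are `x_v` and `y_v`. -/
abbrev CoordField : Type :=
  FractionRing (MvPolynomial ({v : V // v ≠ T.corner 2} × Fin 2) ℚ)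

/-- The point `(x_v, y_v)` for a vertex `v` other than `𝐫`. -/
noncomputable def freePoint (v : {v : V // v ≠ T.corner 2}) : T.CoordField × T.CoordField :=
  (algebraMap _ _ (MvPolynomial.X (R := ℚ) (v, (0 : Fin 2))),
    algebraMap _ _ (MvPolynomial.X (R := ℚ) (v, (1 : Fin 2))))

open Classical in
/-- The generic drawing over the coordinate function field: `v ↦ (x_v, y_v)` for `v ≠ 𝐫`, and
`𝐫 ↦ (x_𝐪 + x_𝐬 - x_𝐩, y_𝐪 + y_𝐬 - y_𝐩)`. -/
noncomputable def genericPoint (v : V) : T.CoordField × T.CoordField :=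
  if h : v ≠ T.corner 2 then T.freePoint ⟨v, h⟩
  else T.freePoint ⟨T.corner 1, T.corner.injective.ne (by decide)⟩
    + T.freePoint ⟨T.corner 3, T.corner.injective.ne (by decide)⟩
    - T.freePoint ⟨T.corner 0, T.corner.injective.ne (by decide)⟩

/-- `f` is a Monsky polynomial of `T`: a homogeneous integer polynomial such that
`2 f(Z_1, …, Z_N) = (Z_1 + ⋯ + Z_N) ^ e` for some `e`, where the `Z_j` are the areas of the
triangles as elements of the coordinate function field. -/
def IsMonskyPolynomial (f : MvPolynomial ι ℤ) : Prop :=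
  (∃ d : ℕ, f.IsHomogeneous d) ∧
  ∃ e : ℕ, 2 * MvPolynomial.aeval (T.areas T.genericPoint) f
    = (∑ j, T.areas T.genericPoint j) ^ e

end SquareTriangulation

/-- The sum `σ` of all variables. -/
noncomputable def sigmaPoly (ι : Type) [Fintype ι] : MvPolynomial ι ℤ :=
  ∑ j, MvPolynomial.X j

/-- A polynomial is positive if all its coefficients are non-negative. -/
def IsPositivePoly {ι : Type} (f : MvPolynomial ι ℤ) : Prop :=
  ∀ m, 0 ≤ f.coeff m

/-- A homogeneous polynomial is small if the absolute value of each coefficient is at most the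
corresponding multinomial coefficient. -/
def IsSmallPoly {ι : Type} (p : MvPolynomial ι ℤ) : Prop :=
  (∃ d : ℕ, p.IsHomogeneous d) ∧ ∀ m : ι →₀ ℕ, |p.coeff m| ≤ (m.multinomial : ℤ)

/-! ### The diagonal case -/

namespace Diagonal

/-- The vertices of the diagonal triangulation: `𝐪`, `𝐬`, and `v_0 = 𝐩, v_1, …, v_n, v_{n+1} = 𝐫`
along the diagonal. -/
abbrev Vertex (n : ℕ) : Type := Fin 2 ⊕ Fin (n + 2)

/-- The triangles of the diagonal triangulation: `A_1, …, A_{n+1}` and `B_1, …, B_{n+1}`. -/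
abbrev Triangle (n : ℕ) : Type := Fin (n + 1) ⊕ Fin (n + 1)

abbrev q (n : ℕ) : Vertex n := Sum.inl 0

abbrev s (n : ℕ) : Vertex n := Sum.inl 1

abbrev v (n : ℕ) (i : Fin (n + 2)) : Vertex n := Sum.inr i

/-- The corners `𝐩, 𝐪, 𝐫, 𝐬`. -/
def corner (n : ℕ) : Fin 4 ↪ Vertex n where
  toFun := ![v n 0, q n, v n (Fin.last (n + 1)), s n]
  inj' := by
    intro a b
    fin_cases a <;> fin_cases b <;> simp [Fin.ext_iff]

/-- `A_{i+1} = (𝐪, v_{i+1}, v_i)` and `B_{i+1} = (𝐬, v_i, v_{i+1})` for `i = 0, …, n`. -/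
def tri (n : ℕ) : Triangle n → Fin 3 ↪ Vertex n
  | Sum.inl i =>
    { toFun := ![q n, v n i.succ, v n i.castSucc]
      inj' := by
        intro a b
        fin_cases a <;> fin_cases b <;> simp [Fin.ext_iff] }
  | Sum.inr i =>
    { toFun := ![s n, v n i.castSucc, v n i.succ]
      inj' := by
        intro a b
        fin_cases a <;> fin_cases b <;> simp [Fin.ext_iff] }

@[simp] theorem tri_inl_zero (n : ℕ) (i) : tri n (Sum.inl i) 0 = q n := rfl
@[simp] theorem tri_inl_one (n : ℕ) (i) : tri n (Sum.inl i) 1 = v n i.succ := rfl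
@[simp] theorem tri_inl_two (n : ℕ) (i) : tri n (Sum.inl i) 2 = v n i.castSucc := rfl
@[simp] theorem tri_inr_zero (n : ℕ) (i) : tri n (Sum.inr i) 0 = s n := rfl
@[simp] theorem tri_inr_one (n : ℕ) (i) : tri n (Sum.inr i) 1 = v n i.castSucc := rfl
@[simp] theorem tri_inr_two (n : ℕ) (i) : tri n (Sum.inr i) 2 = v n i.succ := rfl

/-- The directed edges of the triangles. -/
theorem edge_iff (n : ℕ) (x y : Vertex n) :
    (∃ j a, tri n j a = x ∧ tri n j (a + 1) = y) ↔
      ∃ i : Fin (n + 1),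
        (x = q n ∧ y = v n i.succ) ∨ (x = v n i.succ ∧ y = v n i.castSucc) ∨
        (x = v n i.castSucc ∧ y = q n) ∨ (x = s n ∧ y = v n i.castSucc) ∨
        (x = v n i.castSucc ∧ y = v n i.succ) ∨ (x = v n i.succ ∧ y = s n) := by
  constructor
  · rintro ⟨j | j, a, rfl, rfl⟩ <;> refine ⟨j, ?_⟩ <;> fin_cases a <;> simp [Fin.ext_iff]
  · rintro ⟨i, h⟩
    rcases h with h | h | h | h | h | h
    · exact ⟨Sum.inl i, 0, by simp [h.1], by simp [h.2]⟩
    · exact ⟨Sum.inl i, 1, by simp [h.1], by simp [h.2]⟩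
    · exact ⟨Sum.inl i, 2, by simp [h.1], by simp [h.2]⟩
    · exact ⟨Sum.inr i, 0, by simp [h.1], by simp [h.2]⟩
    · exact ⟨Sum.inr i, 1, by simp [h.1], by simp [h.2]⟩
    · exact ⟨Sum.inr i, 2, by simp [h.1], by simp [h.2]⟩

theorem edge_unique (n : ℕ) (j k : Triangle n) (a b : Fin 3) :
    tri n j a = tri n k b → tri n j (a + 1) = tri n k (b + 1) → j = k := by
  rcases j with j | j <;> rcases k with k | k <;> fin_cases a <;> fin_cases b <;>
    simp [Fin.ext_iff] <;> omega

theorem boundary (n : ℕ) (x y : Vertex n) :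
    ((∃ j a, tri n j a = x ∧ tri n j (a + 1) = y) ∧
      ¬ ∃ j a, tri n j a = y ∧ tri n j (a + 1) = x) ↔
      ∃ c, x = corner n c ∧ y = corner n (c + 1) := by
  have hc : (∃ c, x = corner n c ∧ y = corner n (c + 1)) ↔
      (x = v n 0 ∧ y = q n) ∨ (x = q n ∧ y = v n (Fin.last (n + 1))) ∨
      (x = v n (Fin.last (n + 1)) ∧ y = s n) ∨ (x = s n ∧ y = v n 0) := by
    constructor
    · rintro ⟨c, rfl, rfl⟩
      fin_cases c
      · exact Or.inl ⟨rfl, rfl⟩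
      · exact Or.inr (Or.inl ⟨rfl, rfl⟩)
      · exact Or.inr (Or.inr (Or.inl ⟨rfl, rfl⟩))
      · exact Or.inr (Or.inr (Or.inr ⟨rfl, rfl⟩))
    · rintro (h | h | h | h)
      · exact ⟨0, h.1, h.2⟩
      · exact ⟨1, h.1, h.2⟩
      · exact ⟨2, h.1, h.2⟩
      · exact ⟨3, h.1, h.2⟩
  rw [hc, edge_iff, edge_iff]
  have h1 : ∀ m : Fin (n + 2), (∃ i : Fin (n + 1), m = i.succ) ↔ m ≠ 0 := fun m => by
    simpa [eq_comm] using Fin.exists_succ_eq (x := m)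
  have h2 : ∀ m : Fin (n + 2), (∃ i : Fin (n + 1), m = i.castSucc) ↔ m ≠ Fin.last (n + 1) :=
    fun m => by simpa [eq_comm] using Fin.exists_castSucc_eq (i := m)
  rcases x with x | x <;> rcases y with y | y
  · simp
  · fin_cases x
    · have := h1 y; have := h2 y; simp_all
    · have := h1 y; have := h2 y; simp_all
  · fin_cases y
    · have := h1 x; have := h2 x; simp_all
    · have := h1 x; have := h2 x; simp_all
  · simp only [reduceCtorEq, false_and, and_false, false_or, or_false, Sum.inr.injEq]
    constructor
    · rintro ⟨⟨i, h⟩, h'⟩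
      exact h' ⟨i, h.symm.imp And.symm And.symm⟩
    · simp

theorem covers (n : ℕ) (x : Vertex n) : ∃ j a, tri n j a = x := by
  rcases x with x | x
  · fin_cases x
    · exact ⟨Sum.inl 0, 0, rfl⟩
    · exact ⟨Sum.inr 0, 0, rfl⟩
  · induction x using Fin.cases with
    | zero => exact ⟨Sum.inr 0, 1, rfl⟩
    | succ i => exact ⟨Sum.inl i, 1, rfl⟩

theorem connected (n : ℕ) (j k : Triangle n) : Relation.ReflTransGen
    (fun j k => ∃ a b, tri n j a = tri n k (b + 1) ∧ tri n j (a + 1) = tri n k b) j k := by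
  set R := fun j k => ∃ a b, tri n j a = tri n k (b + 1) ∧ tri n j (a + 1) = tri n k b with hR
  have hsymm : ∀ j k, Relation.ReflTransGen R j k → Relation.ReflTransGen R k j := by
    intro j k h
    have hs : Std.Symm R := ⟨fun j k ⟨a, b, h1, h2⟩ => ⟨b, a, h2.symm, h1.symm⟩⟩
    exact symm h
  have hlr : ∀ i, Relation.ReflTransGen R (Sum.inl i) (Sum.inr i) := fun i =>
    Relation.ReflTransGen.single ⟨1, 1, rfl, rfl⟩
  have hl : ∀ i, Relation.ReflTransGen R (Sum.inl 0) (Sum.inl i) := by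
    intro i
    induction i using Fin.induction with
    | zero => exact Relation.ReflTransGen.refl
    | succ i ih => exact ih.tail ⟨0, 2, rfl, rfl⟩
  have hall : ∀ j, Relation.ReflTransGen R (Sum.inl 0) j := by
    rintro (i | i)
    · exact hl i
    · exact (hl i).trans (hlr i)
  exact (hsymm _ _ (hall j)).trans (hall k)

/-- The diagonal triangulation `𝒯_n`: the square `𝐩𝐪𝐫𝐬` with `n` interior vertices
`v_1, …, v_n`, which subdivide the diagonal from `𝐩` to `𝐫`, each of the edges
`v_i v_{i+1}` of the diagonal being joined to both `𝐪` and `𝐬`. -/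
def triangulation (n : ℕ) : SquareTriangulation (Vertex n) (Triangle n) where
  corner := corner n
  tri := tri n
  covers := covers n
  edge_unique := edge_unique n
  boundary := boundary n
  connected := connected n
  euler := by simp; omega

end Diagonal

/-! Put the origin at the centre of the parallelogram, let `t i` and `δ i` be the sum and the
difference of the areas of the two triangles at the edge from `v_i` to `v_{i+1}`, and let `Y m` be
the cross product of `v_m` with the diagonal from `𝐪` to `𝐬`. Then `2 t i = Y (i+1) - Y i` and `Y
(n+1) = -Y 0`, so the `Y m` are signed sums of the areas (`splitSum`). If `z m` is a coordinate of
`v_m` and `d` the same coordinate of `𝐬 - 𝐪`, then `d * δ i = z i * Y (i+1) - z (i+1) * Y i`. Hence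
`∑ δ i / (Y i * Y (i+1))` telescopes to a multiple of `z 0 / Y 0 - z (n+1) / Y (n+1) = 0`.
Multiplied by `Y 0 ⋯ Y n` this is a form of degree `n` vanishing on all drawings (`areaForm_areas`).

It generates the ideal (`areaForm_dvd_of_eval_areas`): the form is linear in `δ n`, with coefficient
`-Y 1 ⋯ Y (n-1)`, so modulo the form and up to a power of this coefficient each polynomial `F`
becomes a polynomial in the `t i` and the other `δ i`. These can be prescribed almost freely
(`exists_drawing`), so if `F` vanishes on drawings, the reduced polynomial is zero. As no `Y j` with
`1 ≤ j < n` divides the form, the coefficient is coprime to it and the form divides `F`.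

The explicit shape gives the rest. Coefficientwise, `δ i` is bounded by `t i` and `Y m` by `σ`, so
the form is bounded by `(∑ t i) * σ ^ (n-1) = σ ^ n`. Modulo 2 signs do not matter, and the same
computation gives `σ ^ n` itself. -/

namespace Diagonal

open Finset

/-! ### The area form -/

/-- `t_0 + ⋯ + t_{m-1} - t_m - ⋯ - t_n`. -/
def splitSum {n : ℕ} {R : Type*} [CommRing R] (t : Fin (n + 1) → R) (m : ℕ) : R :=
  ∑ i : Fin (n + 1), if (i : ℕ) < m then t i else -t i

/-- The product of all `Y_0, …, Y_n` other than two cyclically consecutive ones, `Y_i` and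
`Y_{i+1}`, with a negative sign for the pair `Y_n, Y_0`. -/
def cofactor {R : Type*} [CommRing R] (n : ℕ) (Y : ℕ → R) (i : ℕ) : R :=
  if i = n then -∏ j ∈ Ico 1 n, Y j else ∏ j ∈ ((range (n + 1)).erase i).erase (i + 1), Y j

/-- The form which vanishes on the areas of each drawing of the diagonal triangulation. -/
def areaForm {n : ℕ} {R : Type*} [CommRing R] (x : Triangle n → R) : R :=
  ∑ i : Fin (n + 1), (x (Sum.inl i) - x (Sum.inr i)) *
    cofactor n (splitSum fun k => x (Sum.inl k) + x (Sum.inr k)) i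

section Ring

variable {n : ℕ} {R S : Type*} [CommRing R] [CommRing S]

theorem map_splitSum (f : R →+* S) (t : Fin (n + 1) → R) (m : ℕ) :
    f (splitSum t m) = splitSum (fun i => f (t i)) m := by
  simp [splitSum, apply_ite f]

theorem map_cofactor (f : R →+* S) (Y : ℕ → R) (i : ℕ) :
    f (cofactor n Y i) = cofactor n (fun j => f (Y j)) i := by
  simp [cofactor, apply_ite f]

theorem map_areaForm (f : R →+* S) (x : Triangle n → R) :
    f (areaForm x) = areaForm (fun j => f (x j)) := by
  simp [areaForm, map_cofactor, map_splitSum]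

theorem splitSum_zero (t : Fin (n + 1) → R) : splitSum t 0 = -∑ i, t i := by
  simp [splitSum]

theorem splitSum_last (t : Fin (n + 1) → R) : splitSum t (n + 1) = ∑ i, t i :=
  Finset.sum_congr rfl fun i _ => if_pos i.2

theorem splitSum_succ (t : Fin (n + 1) → R) (i : Fin (n + 1)) :
    splitSum t (i + 1) = splitSum t i + 2 * t i := by
  rw [← sub_eq_iff_eq_add', splitSum, splitSum, ← Finset.sum_sub_distrib, Finset.sum_eq_single i]
  · simp; ring
  · intro k _ hk
    have : (k : ℕ) ≠ i := fun h => hk (Fin.ext h)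
    rcases lt_or_gt_of_ne this with h | h
    · simp [h, h.trans (Nat.lt_succ_self _)]
    · simp [h.not_gt, (Nat.succ_le_of_lt h).not_gt]
  · simp

/-- A sequence whose increments are `2 t_i`, and whose end points are opposite, is `splitSum t`. -/
theorem splitSum_eq [NoZeroDivisors R] [NeZero (2 : R)] (t : Fin (n + 1) → R) (Y : ℕ → R)
    (h : ∀ i : Fin (n + 1), 2 * t i = Y (i + 1) - Y i) (h0 : Y (n + 1) = -Y 0) (m : ℕ)
    (hm : m ≤ n + 1) : splitSum t m = Y m := by
  induction m with
  | zero =>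
    -- After doubling, the sum telescopes to `Y 0 - Y (n + 1) = 2 * Y 0`.
    apply mul_left_cancel₀ (two_ne_zero (α := R))
    rw [splitSum_zero, mul_neg, Finset.mul_sum, Finset.sum_congr rfl fun i _ => h i,
      Fin.sum_univ_eq_sum_range (fun i => Y (i + 1) - Y i), Finset.sum_range_sub, h0]
    ring
  | succ m ih =>
    have := splitSum_succ t ⟨m, hm⟩
    rw [h ⟨m, hm⟩] at this
    simp only at this
    rw [this, ih (by omega)]
    ring

/-- The telescoping sum `∑ δ_i / (y_i y_{i+1}) = z_0 / y_0 - z_m / y_m`, with the denominators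
cleared. -/
theorem sum_cross_mul_prod (z y : ℕ → R) (m : ℕ) :
    ∑ i ∈ range m, (z i * y (i + 1) - z (i + 1) * y i) *
        ∏ j ∈ ((range (m + 1)).erase i).erase (i + 1), y j =
      z 0 * ∏ j ∈ Ico 1 (m + 1), y j - z m * ∏ j ∈ range m, y j := by
  induction m with
  | zero => simp
  | succ m ih =>
    have h1 : ∀ i ∈ range m, (z i * y (i + 1) - z (i + 1) * y i) *
        ∏ j ∈ ((range (m + 1 + 1)).erase i).erase (i + 1), y j =
        ((z i * y (i + 1) - z (i + 1) * y i) *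
        ∏ j ∈ ((range (m + 1)).erase i).erase (i + 1), y j) * y (m + 1) := by
      intro i hi
      have hi' := mem_range.1 hi
      rw [range_add_one, erase_insert_of_ne (by omega), erase_insert_of_ne (by omega),
        prod_insert (by simp)]
      ring
    have h2 : ((range (m + 1 + 1)).erase m).erase (m + 1) = range m := by
      ext j
      simp only [mem_erase, mem_range]
      omega
    rw [sum_range_succ, sum_congr rfl h1, ← sum_mul, ih, h2,
      prod_Ico_succ_top (show 1 ≤ m + 1 by omega), prod_range_succ]
    ring

/-- The telescoping sum closes up: replacing `y (n + 1)` by `-y 0` in the last denominator produces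
the sign in `cofactor`, and this last term cancels the two boundary terms. -/
theorem sum_cross_mul_cofactor (hn : 1 ≤ n) (z y : ℕ → R) (hz : z (n + 1) = -z 0)
    (hy : y (n + 1) = -y 0) :
    ∑ i : Fin (n + 1), (z i * y (i + 1) - z (i + 1) * y i) * cofactor n y i = 0 := by
  rw [Fin.sum_univ_eq_sum_range fun i => (z i * y (i + 1) - z (i + 1) * y i) * cofactor n y i,
    sum_range_succ, sum_congr (g := fun i => (z i * y (i + 1) - z (i + 1) * y i) *
      ∏ j ∈ ((range (n + 1)).erase i).erase (i + 1), y j) rfl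
      (fun i hi => by rw [cofactor, if_neg (mem_range.1 hi).ne]), sum_cross_mul_prod, cofactor,
      if_pos rfl, prod_Ico_succ_top hn, range_eq_Ico, prod_eq_prod_Ico_succ_bot hn, hz, hy]
  ring

theorem cofactor_two_eq_zero (Y : ℕ → R) (s : R) (h : ∀ m, Y m = s)
    (h2 : (2 : R) = 0) (i : ℕ) (hi : i ≤ n) : cofactor n Y i = s ^ (n - 1) := by
  have hneg : ∀ x : R, -x = x := fun x => by linear_combination (-x) * h2
  unfold cofactor
  split_ifs with h'
  · simp [h, hneg]
  · simp only [h, prod_const]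
    rw [card_erase_of_mem, card_erase_of_mem, card_range]
    · rfl
    · simp; omega
    · simp; omega

/-- Without signs, every `splitSum` is the total sum and each difference is a sum, so all summands
share the factor `σ ^ (n - 1)`. -/
theorem areaForm_of_two_eq_zero (hn : 1 ≤ n) (x : Triangle n → R) (h2 : (2 : R) = 0) :
    areaForm x = (∑ j, x j) ^ n := by
  have hneg : ∀ x : R, -x = x := fun x => by linear_combination (-x) * h2
  have hY : ∀ m, splitSum (fun k => x (Sum.inl k) + x (Sum.inr k)) m = ∑ j, x j := by
    intro m
    simp only [splitSum, hneg, ite_self]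
    rw [Fintype.sum_sum_type, sum_add_distrib]
  unfold areaForm
  rw [sum_congr rfl fun i _ => by rw [cofactor_two_eq_zero _ _ hY h2 i (by omega)],
    ← sum_mul, ← mul_pow_sub_one (Nat.one_le_iff_ne_zero.1 hn) (∑ j, x j), Fintype.sum_sum_type,
    sum_sub_distrib, sub_eq_add_neg, hneg]

/-- A normalisation: it makes the area polynomial primitive and later identifies a complex scalar
factor as an integer. -/
theorem areaForm_single (hn : 1 ≤ n) :
    areaForm (Pi.single (Sum.inl 0) 1 : Triangle n → R) = 1 := by
  have hY : ∀ m, 1 ≤ m → splitSum (fun k => (Pi.single (Sum.inl 0) 1 : Triangle n → R) (Sum.inl k) +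
      (Pi.single (Sum.inl 0) 1 : Triangle n → R) (Sum.inr k)) m = 1 := by
    intro m hm
    rw [splitSum, sum_eq_single 0]
    · simp; omega
    · intro b _ hb
      simp [hb]
    · simp
  rw [areaForm, sum_eq_single 0]
  · rw [cofactor, if_neg (by simp; omega), prod_congr rfl fun j hj => hY j _, prod_const_one]
    · simp
    · intro j hj
      simp only [Fin.coe_ofNat_eq_mod, Nat.zero_mod, mem_erase] at hj
      omega
  · intro b _ hb
    simp [Pi.single_apply, hb]
  · simp

end Ring

/-! ### The area polynomial -/

open MvPolynomial

/-- The area polynomial of the diagonal triangulation. -/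
noncomputable def areaPoly (n : ℕ) : MvPolynomial (Triangle n) ℤ := areaForm X

variable {n : ℕ}

theorem eval₂_areaPoly {R : Type*} [CommRing R] (f : ℤ →+* R) (x : Triangle n → R) :
    eval₂Hom f x (areaPoly n) = areaForm x := by
  simp [areaPoly, map_areaForm]

theorem eval_map_areaPoly {R : Type*} [CommRing R] (f : ℤ →+* R) (x : Triangle n → R) :
    eval x (map f (areaPoly n)) = areaForm x := by
  rw [eval_map, ← eval₂_areaPoly f, coe_eval₂Hom]

theorem map_areaPoly {R : Type*} [CommRing R] (f : ℤ →+* R) :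
    map f (areaPoly n) = areaForm (X : Triangle n → MvPolynomial _ R) := by
  simp [areaPoly, map_areaForm]

theorem isHomogeneous_splitSum {σ R : Type*} [CommRing R] {t : Fin (n + 1) → MvPolynomial σ R}
    (ht : ∀ i, (t i).IsHomogeneous 1) (m : ℕ) : (splitSum t m).IsHomogeneous 1 :=
  IsHomogeneous.sum _ _ _ fun i _ => by split_ifs; exacts [ht i, (ht i).neg]

theorem isHomogeneous_cofactor {σ R : Type*} [CommRing R] {Y : ℕ → MvPolynomial σ R}
    (hY : ∀ i, (Y i).IsHomogeneous 1) (i : ℕ) (hi : i ≤ n) :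
    (cofactor n Y i).IsHomogeneous (n - 1) := by
  unfold cofactor
  split_ifs with h
  · have := IsHomogeneous.prod (Ico 1 n) Y (fun _ => 1) fun i _ => hY i
    simpa using this.neg
  · have := IsHomogeneous.prod (((range (n + 1)).erase i).erase (i + 1)) Y (fun _ => 1)
      fun i _ => hY i
    rwa [sum_const, smul_eq_mul, mul_one, card_erase_of_mem, card_erase_of_mem, card_range] at this
    · simp; omega
    · simp; omega

theorem isHomogeneous_areaPoly (hn : 1 ≤ n) : (areaPoly n).IsHomogeneous n := by
  refine IsHomogeneous.sum _ _ _ fun i _ => ?_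
  conv => arg 2; rw [← Nat.add_sub_cancel' hn]
  exact ((isHomogeneous_X _ _).sub (isHomogeneous_X _ _)).mul (isHomogeneous_cofactor
    (isHomogeneous_splitSum fun i => (isHomogeneous_X _ _).add (isHomogeneous_X _ _)) _ (by omega))

/-! ### Coefficientwise domination -/

/-- The coefficients of `f` are bounded in absolute value by those of `g`. -/
def IsDominated {σ : Type*} (f g : MvPolynomial σ ℤ) : Prop :=
  ∀ m, |f.coeff m| ≤ g.coeff m

namespace IsDominated

variable {σ κ : Type*} {f f' g g' : MvPolynomial σ ℤ}

theorem neg (h : IsDominated f g) : IsDominated (-f) g := fun m => by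
  simpa using h m

theorem add (h : IsDominated f g) (h' : IsDominated f' g') : IsDominated (f + f') (g + g') :=
  fun m => by
    rw [coeff_add, coeff_add]
    exact (abs_add_le _ _).trans (add_le_add (h m) (h' m))

theorem sub (h : IsDominated f g) (h' : IsDominated f' g') : IsDominated (f - f') (g + g') := by
  rw [sub_eq_add_neg]
  exact h.add h'.neg

theorem mul (h : IsDominated f g) (h' : IsDominated f' g') : IsDominated (f * f') (g * g') := by
  classical
  intro m
  rw [coeff_mul, coeff_mul]
  refine (abs_sum_le_sum_abs _ _).trans (sum_le_sum fun x _ => ?_)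
  rw [abs_mul]
  exact mul_le_mul (h _) (h' _) (abs_nonneg _) ((abs_nonneg _).trans (h _))

theorem sum {s : Finset κ} {F G : κ → MvPolynomial σ ℤ} (h : ∀ i ∈ s, IsDominated (F i) (G i)) :
    IsDominated (∑ i ∈ s, F i) (∑ i ∈ s, G i) := by
  intro m
  rw [coeff_sum, coeff_sum]
  exact (abs_sum_le_sum_abs _ _).trans (sum_le_sum fun i hi => h i hi m)

theorem one : IsDominated (1 : MvPolynomial σ ℤ) 1 := by
  classical
  intro m
  rw [coeff_one]
  split_ifs <;> simp

theorem prod {s : Finset κ} {F : κ → MvPolynomial σ ℤ} (h : ∀ i, IsDominated (F i) g) :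
    IsDominated (∏ i ∈ s, F i) (g ^ s.card) := by
  classical
  induction s using Finset.induction_on with
  | empty => simpa using one
  | insert a s ha ih =>
    rw [prod_insert ha, card_insert_of_notMem ha, pow_succ']
    exact (h a).mul ih

theorem X (i : σ) : IsDominated (X i : MvPolynomial σ ℤ) (X i) := by
  classical
  intro m
  rw [coeff_X]
  split_ifs <;> simp

end IsDominated

theorem isDominated_areaPoly (hn : 1 ≤ n) :
    IsDominated (areaPoly n) (sigmaPoly (Triangle n) ^ n) := by
  have hσ : sigmaPoly (Triangle n) = ∑ i : Fin (n + 1), (X (Sum.inl i) + X (Sum.inr i)) := by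
    rw [sigmaPoly, Fintype.sum_sum_type, sum_add_distrib]
  have ht : ∀ i : Fin (n + 1), IsDominated
      (X (Sum.inl i) + X (Sum.inr i) : MvPolynomial (Triangle n) ℤ)
      (X (Sum.inl i) + X (Sum.inr i)) := fun i => (IsDominated.X _).add (IsDominated.X _)
  have hY : ∀ m, IsDominated (splitSum (n := n) (fun k => X (Sum.inl k) + X (Sum.inr k)) m)
      (sigmaPoly (Triangle n)) := by
    intro m
    rw [hσ]
    refine IsDominated.sum fun i _ => ?_
    split_ifs
    exacts [ht i, (ht i).neg]
  have hc : ∀ i ≤ n, IsDominated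
      (cofactor n (splitSum (n := n) (fun k => X (Sum.inl k) + X (Sum.inr k))) i)
      (sigmaPoly (Triangle n) ^ (n - 1)) := by
    intro i hi
    unfold cofactor
    split_ifs with h
    · simpa using (IsDominated.prod (s := Ico 1 n) hY).neg
    · have := IsDominated.prod (s := ((range (n + 1)).erase i).erase (i + 1)) hY
      rwa [card_erase_of_mem, card_erase_of_mem, card_range] at this
      · simp; omega
      · simp; omega
  rw [← mul_pow_sub_one (Nat.one_le_iff_ne_zero.1 hn)]
  conv => arg 2; arg 1; rw [hσ]
  rw [sum_mul]
  exact IsDominated.sum fun i _ =>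
    ((IsDominated.X _).sub (IsDominated.X _)).mul (hc i (by omega))

theorem coeff_sigmaPoly_pow {ι : Type} [Fintype ι] (k : ℕ) (m : ι →₀ ℕ) :
    (sigmaPoly ι ^ k).coeff m = if m.sum (fun _ a => a) = k then (m.multinomial : ℤ) else 0 := by
  rw [sigmaPoly, coeff_sum_X_pow_of_fintype]
  split_ifs <;> simp

theorem isSmallPoly_areaPoly (hn : 1 ≤ n) : IsSmallPoly (areaPoly n) := by
  refine ⟨⟨n, isHomogeneous_areaPoly hn⟩, fun m => (isDominated_areaPoly hn m).trans ?_⟩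
  rw [coeff_sigmaPoly_pow]
  split_ifs <;> simp

/-- `σ ^ n + p` is twice an integral polynomial. -/
theorem exists_two_mul_eq (hn : 1 ≤ n) :
    ∃ f, 2 * f = sigmaPoly (Triangle n) ^ n + areaPoly n := by
  -- Modulo 2 both summands become `σ ^ n`.
  let I : Ideal (MvPolynomial (Triangle n) ℤ) := Ideal.span {2}
  have h2 : (2 : MvPolynomial (Triangle n) ℤ ⧸ I) = 0 :=
    (map_ofNat (Ideal.Quotient.mk I) 2).symm.trans
      (Ideal.Quotient.eq_zero_iff_mem.2 (Ideal.subset_span rfl))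
  have h : Ideal.Quotient.mk I (sigmaPoly (Triangle n) ^ n + areaPoly n) = 0 := by
    rw [map_add, areaPoly, map_areaForm, areaForm_of_two_eq_zero hn _ h2, sigmaPoly, map_pow,
      map_sum, ← two_mul, h2, zero_mul]
  obtain ⟨f, hf⟩ := Ideal.mem_span_singleton.1 (Ideal.Quotient.eq_zero_iff_mem.1 h)
  exact ⟨f, hf.symm⟩

theorem isHomogeneous_sigmaPoly_pow {ι : Type} [Fintype ι] (k : ℕ) :
    (sigmaPoly ι ^ k).IsHomogeneous k := by
  have : (sigmaPoly ι).IsHomogeneous 1 := IsHomogeneous.sum _ _ _ fun i _ => isHomogeneous_X _ _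
  simpa using this.pow k

theorem coeff_two_mul {σ : Type*} (f : MvPolynomial σ ℤ) (m : σ →₀ ℕ) :
    (2 * f).coeff m = 2 * f.coeff m := by
  rw [show (2 : MvPolynomial σ ℤ) = C 2 by simp, coeff_C_mul]

theorem isHomogeneous_of_two_mul {σ : Type*} {f : MvPolynomial σ ℤ} {k : ℕ}
    (h : (2 * f).IsHomogeneous k) : f.IsHomogeneous k := by
  intro m hm
  exact h (by rw [coeff_two_mul]; simpa using hm)

end Diagonal

/-! ### Density of the generic drawings -/

theorem triangleArea_eq {F : Type*} [Field F] (a b c : F × F) :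
    triangleArea a b c = 1 / 2 * ((b.1 - a.1) * (c.2 - a.2) - (c.1 - a.1) * (b.2 - a.2)) := by
  rw [triangleArea, Matrix.det_fin_three]
  simp [-mul_eq_mul_left_iff]
  ring

/-- The area of a triangle is a quadratic polynomial along a line of triangles. -/
theorem exists_triangleArea_line {F : Type*} [Field F] (a b c a' b' c' : F × F) :
    ∃ p : Polynomial F, ∀ ε,
      triangleArea (a + ε • (a' - a)) (b + ε • (b' - b)) (c + ε • (c' - c)) = p.eval ε := by
  let L : F × F → F × F → Polynomial F × Polynomial F := fun x y =>
    (Polynomial.C x.1 + Polynomial.X * Polynomial.C (y.1 - x.1),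
      Polynomial.C x.2 + Polynomial.X * Polynomial.C (y.2 - x.2))
  refine ⟨Polynomial.C (1 / 2) * (((L b b').1 - (L a a').1) * ((L c c').2 - (L a a').2) -
    ((L c c').1 - (L a a').1) * ((L b b').2 - (L a a').2)), fun ε => ?_⟩
  simp [L, triangleArea_eq]

theorem Polynomial.eventually_eval_ne_zero {p : Polynomial ℂ} (hp : p ≠ 0) (a : ℂ) :
    ∀ᶠ ε in nhdsWithin a {a}ᶜ, p.eval ε ≠ 0 := by
  have hfin : {ε | p.eval ε = 0}.Finite := by
    refine p.roots.toFinset.finite_toSet.subset fun ε hε => ?_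
    simpa [hp] using hε
  rw [eventually_nhdsWithin_iff]
  filter_upwards [(hfin.sdiff (t := {a})).isClosed.isOpen_compl.mem_nhds (by simp)] with ε hε ha h
  exact hε ⟨h, ha⟩

namespace SquareTriangulation

open Filter Topology

variable {V ι : Type} [Fintype V] [Fintype ι] (T : SquareTriangulation V ι)

theorem areas_continuous : Continuous fun ρ : V → ℂ × ℂ => T.areas ρ := by
  refine continuous_pi fun j => ?_
  simp only [areas, triangleArea_eq]
  fun_prop

/-- If there is a generic drawing, then the generic drawings are dense in the set of all
drawings. -/
theorem drawingSpace_eq {ρ₀ : V → ℂ × ℂ} (h₀ : T.IsGeneric ρ₀) :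
    T.drawingSpace = {ρ | T.IsDrawing ρ} := by
  refine Set.Subset.antisymm (closure_minimal (fun ρ hρ => hρ.isDrawing) ?_) fun ρ hρ => ?_
  · exact isClosed_eq (by fun_prop) (by fun_prop)
  -- On the line from `ρ` to `ρ₀` each genericity condition says that a polynomial in `ε` is
  -- non-zero. It holds at `ε = 1`, so it fails for only finitely many `ε`, and `ε → 0` through
  -- generic drawings.
  let L : ℂ → V → ℂ × ℂ := fun ε w => ρ w + ε • (ρ₀ w - ρ w)
  have hL1 : ∀ w, L 1 w = ρ₀ w := fun w => by simp [L]
  have area : ∀ a b c, triangleArea (ρ₀ a) (ρ₀ b) (ρ₀ c) ≠ 0 →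
      ∀ᶠ ε in 𝓝[≠] (0 : ℂ), triangleArea (L ε a) (L ε b) (L ε c) ≠ 0 := by
    intro a b c h
    obtain ⟨p, hp⟩ := exists_triangleArea_line (ρ a) (ρ b) (ρ c) (ρ₀ a) (ρ₀ b) (ρ₀ c)
    have hp0 : p ≠ 0 := by
      rintro rfl
      apply h
      rw [← hL1, ← hL1, ← hL1, hp, Polynomial.eval_zero]
    filter_upwards [Polynomial.eventually_eval_ne_zero hp0 0] with ε hε
    rwa [hp]
  have coord : ∀ a b : ℂ, a + b ≠ 0 → ∀ᶠ ε in 𝓝[≠] (0 : ℂ), a + ε * b ≠ 0 := by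
    intro a b h
    have hp0 : Polynomial.C a + Polynomial.X * Polynomial.C b ≠ 0 := fun h0 => h (by
      simpa using congrArg (Polynomial.eval 1) h0)
    filter_upwards [Polynomial.eventually_eval_ne_zero hp0 0] with ε hε
    rwa [Polynomial.eval_add, Polynomial.eval_mul, Polynomial.eval_C, Polynomial.eval_C,
      Polynomial.eval_X] at hε
  have inj : ∀ a b, a ≠ b → ∀ᶠ ε in 𝓝[≠] (0 : ℂ), L ε a ≠ L ε b := by
    intro a b hab
    have h := h₀.injective.ne hab
    rw [Ne, Prod.ext_iff, not_and_or, ← sub_eq_zero, ← sub_eq_zero (b := (ρ₀ b).2)] at h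
    rcases h with h | h
    · filter_upwards [coord ((ρ a).1 - (ρ b).1) ((ρ₀ a).1 - (ρ a).1 - ((ρ₀ b).1 - (ρ b).1))
        (by convert! h using 1; ring)] with ε hε h'
      apply hε
      have := congrArg Prod.fst h'
      simp only [L, Prod.fst_add, Prod.smul_fst, Prod.fst_sub, smul_eq_mul] at this
      linear_combination this
    · filter_upwards [coord ((ρ a).2 - (ρ b).2) ((ρ₀ a).2 - (ρ a).2 - ((ρ₀ b).2 - (ρ b).2))
        (by convert! h using 1; ring)] with ε hε h'
      apply hε
      have := congrArg Prod.snd h'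
      simp only [L, Prod.snd_add, Prod.smul_snd, Prod.snd_sub, smul_eq_mul] at this
      linear_combination this
  have hgen : ∀ᶠ ε in 𝓝[≠] (0 : ℂ), L ε ∈ {ρ | T.IsGeneric ρ} := by
    have h1 := eventually_all.2 fun c => area _ _ _ (h₀.corners c)
    have h2 := eventually_all.2 fun j => area _ _ _ (h₀.triangles j)
    have h3 : ∀ᶠ ε in 𝓝[≠] (0 : ℂ), ∀ a b, a ≠ b → L ε a ≠ L ε b := by
      simp only [eventually_all]
      exact inj
    filter_upwards [h1, h2, h3] with ε h1 h2 h3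
    refine ⟨?_, h1, h2, fun a b hab => by_contra fun h => h3 a b h hab⟩
    have e1 : ρ _ + ρ _ = ρ _ + ρ _ := hρ
    have e2 : ρ₀ _ + ρ₀ _ = ρ₀ _ + ρ₀ _ := h₀.isDrawing
    obtain ⟨e11, e12⟩ := Prod.ext_iff.1 e1
    obtain ⟨e21, e22⟩ := Prod.ext_iff.1 e2
    simp only [Prod.fst_add, Prod.snd_add] at e11 e12 e21 e22
    ext <;> simp [L]
    · linear_combination (1 - ε) * e11 + ε * e21
    · linear_combination (1 - ε) * e12 + ε * e22
  have hlim : Tendsto L (𝓝[≠] (0 : ℂ)) (𝓝 ρ) := by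
    have : Continuous L := by fun_prop
    have := this.tendsto 0
    rw [show L 0 = ρ by ext w <;> simp [L]] at this
    exact this.mono_left nhdsWithin_le_nhds
  exact mem_closure_of_tendsto hlim hgen

end SquareTriangulation

/-! ### Drawings of the diagonal triangulation and their areas -/

namespace Diagonal

open Finset MvPolynomial

variable {n : ℕ}

@[simp] theorem triangulation_corner_zero (n : ℕ) : (triangulation n).corner 0 = v n 0 := rfl

@[simp] theorem triangulation_corner_one (n : ℕ) : (triangulation n).corner 1 = q n := rfl

@[simp] theorem triangulation_corner_two (n : ℕ) :
    (triangulation n).corner 2 = v n (Fin.last (n + 1)) := rfl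

@[simp] theorem triangulation_corner_three (n : ℕ) : (triangulation n).corner 3 = s n := rfl

@[simp] theorem triangulation_tri (n : ℕ) : (triangulation n).tri = tri n := rfl

theorem exists_isGeneric (n : ℕ) : ∃ ρ, (triangulation n).IsGeneric ρ := by
  have hn : (n : ℂ) + 1 ≠ 0 := by exact_mod_cast n.succ_ne_zero
  -- The diagonal is vertical with `v_i` at height `i`; `𝐪` and `𝐬` lie on either side, their
  -- midpoint being that of `𝐩` and `𝐫`.
  refine ⟨Sum.elim ![(1, 0), (-1, n + 1)] fun i => (0, (i : ℕ)), ?_, ?_, ?_, ?_⟩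
  · simp [SquareTriangulation.IsDrawing]
  · intro c
    fin_cases c
    · simpa [triangleArea_eq] using hn
    · simp [triangleArea_eq]
      convert! hn using 2
      ring
    · simpa [triangleArea_eq] using hn
    · simp [triangleArea_eq]
      convert! hn using 2
      ring
  · rintro (j | j) <;> simp [SquareTriangulation.areas, triangleArea_eq]
  · rintro (a | a) (b | b) h
    · fin_cases a <;> fin_cases b <;> first | rfl | norm_num [Prod.ext_iff] at h
    · fin_cases a <;> simp [Prod.ext_iff] at h
    · fin_cases b <;> simp [Prod.ext_iff] at h
    · simpa [Prod.ext_iff, Fin.ext_iff] using h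

/-- The area form vanishes on the areas of a drawing over any field. -/
theorem areaForm_areas {F : Type*} [Field F] [NeZero (2 : F)] (hn : 1 ≤ n)
    (ρ : Vertex n → F × F) (hρ : ρ (v n 0) + ρ (v n (Fin.last (n + 1))) = ρ (q n) + ρ (s n))
    (hqs : ρ (q n) ≠ ρ (s n)) : areaForm ((triangulation n).areas ρ) = 0 := by
  have h2 : (2 : F) ≠ 0 := two_ne_zero
  obtain ⟨hρ1, hρ2⟩ := Prod.ext_iff.1 hρ
  simp only [Prod.fst_add, Prod.snd_add] at hρ1 hρ2
  set x := (triangulation n).areas ρ with hx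
  have hA : ∀ i : Fin (n + 1), x (Sum.inl i) =
      triangleArea (ρ (q n)) (ρ (v n i.succ)) (ρ (v n i.castSucc)) := fun _ => rfl
  have hB : ∀ i : Fin (n + 1), x (Sum.inr i) =
      triangleArea (ρ (s n)) (ρ (v n i.castSucc)) (ρ (v n i.succ)) := fun _ => rfl
  -- Indices wrap around modulo `n + 2`, but only `m ≤ n + 1` is used.
  let W : ℕ → F × F := fun m => ρ (v n (Fin.ofNat (n + 2) m))
  have hW : ∀ i : Fin (n + 1), ρ (v n i.castSucc) = W i := fun i => by
    simp only [W]; congr 2; ext; simp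
  have hW' : ∀ i : Fin (n + 1), ρ (v n i.succ) = W (i + 1) := fun i => by
    simp only [W]; congr 2; ext; simp [Nat.mod_eq_of_lt (show (i : ℕ) + 1 < n + 2 by omega)]
  have hW0 : ρ (v n 0) = W 0 := hW 0
  have hWl : ρ (v n (Fin.last (n + 1))) = W (n + 1) := hW' (Fin.last n)
  simp only [hW, hW', triangleArea_eq] at hA hB
  rw [hW0, hWl] at hρ1 hρ2
  generalize ρ (q n) = Q, ρ (s n) = S at *
  -- Coordinates relative to the centre of the parallelogram, which make `𝐩` and `𝐫` opposite.
  let z₁ : ℕ → F := fun m => (W m).1 - (Q.1 + S.1) / 2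
  let z₂ : ℕ → F := fun m => (W m).2 - (Q.2 + S.2) / 2
  let Y : ℕ → F := fun m => z₁ m * (S.2 - Q.2) - z₂ m * (S.1 - Q.1)
  have hz₁ : z₁ (n + 1) = -z₁ 0 := by
    simp only [z₁]; field_simp; linear_combination 2 * hρ1
  have hz₂ : z₂ (n + 1) = -z₂ 0 := by
    simp only [z₂]; field_simp; linear_combination 2 * hρ2
  have hY0 : Y (n + 1) = -Y 0 := by
    simp only [Y, hz₁, hz₂]; ring
  have hY : ∀ m ≤ n + 1, splitSum (fun k => x (Sum.inl k) + x (Sum.inr k)) m = Y m := by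
    refine splitSum_eq _ _ (fun i => ?_) hY0
    rw [hA, hB]
    simp only [Y, z₁, z₂]
    field_simp
    ring
  have hc : ∀ i ≤ n, cofactor n (splitSum fun k => x (Sum.inl k) + x (Sum.inr k)) i =
      cofactor n Y i := by
    intro i hi
    unfold cofactor
    split_ifs
    · rw [prod_congr rfl fun j hj => hY j (by simp at hj; omega)]
    · exact prod_congr rfl fun j hj => hY j (by simp at hj; omega)
  -- Either coordinate will do, provided `𝐪` and `𝐬` differ in it.
  have key : ∀ (z : ℕ → F) (d : F), z (n + 1) = -z 0 →
      (∀ i : Fin (n + 1), d * (x (Sum.inl i) - x (Sum.inr i)) =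
        z i * Y (i + 1) - z (i + 1) * Y i) → d ≠ 0 → areaForm x = 0 := by
    intro z d hz h hd
    apply mul_left_cancel₀ hd
    rw [areaForm, mul_sum, mul_zero, ← sum_cross_mul_cofactor hn z Y hz hY0]
    exact sum_congr rfl fun i _ => by rw [← h, hc i (by omega), mul_assoc]
  rw [Ne, Prod.ext_iff, not_and_or] at hqs
  rcases hqs with h | h
  · refine key z₁ (S.1 - Q.1) hz₁ (fun i => ?_) (sub_ne_zero.2 (Ne.symm h))
    rw [hA, hB]
    simp only [Y, z₁, z₂]
    field_simp
    ring
  · refine key z₂ (S.2 - Q.2) hz₂ (fun i => ?_) (sub_ne_zero.2 (Ne.symm h))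
    rw [hA, hB]
    simp only [Y, z₁, z₂]
    field_simp
    ring

/-- The sums of the areas of opposite triangles and all but one of the differences can be
prescribed, away from the zeros of the linear forms `splitSum t j`. -/
theorem exists_drawing (t : Fin (n + 1) → ℂ) (δ : Fin n → ℂ)
    (hY : ∀ j ≤ n, splitSum t j ≠ 0) :
    ∃ ρ, (triangulation n).IsDrawing ρ ∧
      (∀ i, (triangulation n).areas ρ (Sum.inl i) + (triangulation n).areas ρ (Sum.inr i) = t i) ∧
      ∀ i : Fin n, (triangulation n).areas ρ (Sum.inl i.castSucc) -
        (triangulation n).areas ρ (Sum.inr i.castSucc) = δ i := by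
  -- With `𝐪`, `𝐬` at `(∓1, 0)`, the sums `t` fix the heights of the `v_m`, and the differences give
  -- a recursion for their abscissas that divides by `splitSum t i`.
  obtain ⟨x, hx0, hx⟩ : ∃ x : ℕ → ℂ, x 0 = 0 ∧
      ∀ i : Fin n, 2 * δ i = x i * splitSum t (i + 1) - x (i + 1) * splitSum t i := by
    refine ⟨fun m => Nat.rec 0 (fun i xi => (xi * splitSum t (i + 1) -
      2 * (if h : i < n then δ ⟨i, h⟩ else 0)) / splitSum t i) m, rfl, fun i => ?_⟩
    simp only [i.2, dif_pos, Fin.eta]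
    rw [div_mul_cancel₀ _ (hY i (by omega))]
    ring
  -- The abscissa of `𝐫` must be opposite to that of `𝐩`, hence `0`; this is why the last difference
  -- is not free.
  refine ⟨Sum.elim ![(-1, 0), (1, 0)] fun m =>
    (if m = Fin.last (n + 1) then 0 else x m, -splitSum t m / 2), ?_, fun i => ?_, fun i => ?_⟩
  · simp [SquareTriangulation.IsDrawing, hx0, splitSum_zero, splitSum_last]
    ring
  · have := splitSum_succ t i
    simp [SquareTriangulation.areas, triangleArea_eq, this]
    ring
  · have := hx i
    have h1 : i.castSucc.castSucc ≠ Fin.last (n + 1) := Fin.castSucc_ne_last _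
    have h2 : i.castSucc.succ ≠ Fin.last (n + 1) := by
      rw [Fin.succ_castSucc]; exact Fin.castSucc_ne_last _
    simp [SquareTriangulation.areas, triangleArea_eq, h1, h2]
    linear_combination (-1 / 2) * this

end Diagonal

/-! ### Homogeneous polynomials over a field -/

namespace MvPolynomial

variable {σ K : Type*} [Field K]

theorem IsHomogeneous.eval_smul {F : MvPolynomial σ K} {d : ℕ} (hF : F.IsHomogeneous d) (c : K)
    (x : σ → K) : eval (c • x) F = c ^ d * eval x F := by
  rw [eval_eq, eval_eq, Finset.mul_sum]
  refine Finset.sum_congr rfl fun m hm => ?_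
  rw [hF.degree_eq_sum_deg_support hm, ← Finset.prod_pow_eq_pow_sum]
  simp only [Pi.smul_apply, smul_eq_mul, mul_pow, Finset.prod_mul_distrib]
  ring

theorem IsHomogeneous.eval_rep_mk_eq_zero_iff {F : MvPolynomial σ K} {d : ℕ}
    (hF : F.IsHomogeneous d) (x : σ → K) (hx : x ≠ 0) :
    eval (Projectivization.mk K x hx).rep F = 0 ↔ eval x F = 0 := by
  obtain ⟨a, ha⟩ := Projectivization.exists_smul_eq_mk_rep K x hx
  rw [← ha, Units.smul_def, hF.eval_smul]
  simp

/-- A non-zero linear form over a field is irreducible. -/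
theorem IsHomogeneous.irreducible_of_degree_one {F : MvPolynomial σ K} (hF : F.IsHomogeneous 1)
    (h0 : F ≠ 0) : Irreducible F := by
  refine irreducible_of_totalDegree_eq_one (hF.totalDegree h0) fun x hx => ?_
  obtain ⟨m, hm⟩ := exists_coeff_ne_zero h0
  exact isUnit_iff_ne_zero.2 fun h => hm (zero_dvd_iff.1 (h ▸ hx m))

end MvPolynomial

/-! ### The area form generates the vanishing ideal -/

namespace Diagonal

open Finset MvPolynomial

variable {n : ℕ}

theorem areaForm_areas_of_mem_drawingSpace (hn : 1 ≤ n) {ρ : Vertex n → ℂ × ℂ}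
    (hρ : ρ ∈ (triangulation n).drawingSpace) : areaForm ((triangulation n).areas ρ) = 0 := by
  have hcl : IsClosed {ρ : Vertex n → ℂ × ℂ | areaForm ((triangulation n).areas ρ) = 0} := by
    simp only [← eval_map_areaPoly (Int.castRingHom ℂ)]
    exact isClosed_eq ((MvPolynomial.continuous_eval _).comp (triangulation n).areas_continuous)
      continuous_const
  refine closure_minimal (fun ρ hρ => ?_) hcl hρ
  exact areaForm_areas hn ρ hρ.isDrawing (hρ.injective.ne (by simp))

theorem splitSum_single_ne_zero {R : Type*} [CommRing R] [Nontrivial R] (m : ℕ) :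
    splitSum (Pi.single (0 : Fin (n + 1)) (1 : R)) m ≠ 0 := by
  rw [splitSum, sum_eq_single 0 (fun i _ hi => by simp [hi]) (by simp)]
  split_ifs <;> simp

/-- The sum of the two triangles at an edge of the diagonal. -/
noncomputable def edgeSum (i : Fin (n + 1)) : MvPolynomial (Triangle n) ℂ :=
  X (Sum.inl i) + X (Sum.inr i)

theorem irreducible_splitSum (m : ℕ) :
    Irreducible (splitSum (edgeSum (n := n)) m) := by
  refine (isHomogeneous_splitSum
    (fun i => (isHomogeneous_X _ _).add (isHomogeneous_X _ _)) m).irreducible_of_degree_one ?_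
  intro h
  apply splitSum_single_ne_zero (n := n) (R := ℂ) m
  have := congrArg (eval (Pi.single (Sum.inl 0) 1)) h
  rw [map_splitSum, map_zero] at this
  rw [← this]
  congr 1
  ext i
  by_cases hi : i = 0
  · subst hi; simp
  · simp [hi]

/-- Witnessed by a point where, among `Y 0, …, Y n`, only `Y (j + 1)` vanishes and only the
difference `δ j` is non-zero: the one surviving term omits the factor `Y (j + 1)`. -/
theorem not_splitSum_dvd (j : ℕ) (hj : j + 1 < n) :
    ¬ splitSum (edgeSum (n := n)) (j + 1) ∣ areaForm X := by
  let Y : ℕ → ℂ := fun m => if m ≤ n then m - (j + 1) else j + 1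
  let t : Fin (n + 1) → ℂ := fun i => (Y (i + 1) - Y i) / 2
  let δ : Fin (n + 1) → ℂ := Pi.single ⟨j, by omega⟩ 1
  let x : Triangle n → ℂ := Sum.elim (fun i => (t i + δ i) / 2) fun i => (t i - δ i) / 2
  have ht : (fun i => x (Sum.inl i) + x (Sum.inr i)) = t := by
    ext i; simp [x]; ring
  have hδ : ∀ i, x (Sum.inl i) - x (Sum.inr i) = δ i := by
    intro i; simp [x]; ring
  have hY : ∀ m ≤ n, splitSum t m = m - (j + 1) := by
    intro m hm
    rw [splitSum_eq t Y (fun i => by simp only [t]; ring) (by simp [Y]) m (by omega)]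
    simp [Y, hm]
  have hP : areaForm x ≠ 0 := by
    rw [areaForm, sum_eq_single (⟨j, by omega⟩ : Fin (n + 1)) (fun i _ hi => by
      rw [hδ]; simp [δ, hi]) (by simp), hδ, ht, cofactor, if_neg (by simp; omega)]
    simp only [δ, Pi.single_eq_same, one_mul]
    refine prod_ne_zero_iff.2 fun m hm => ?_
    simp only [mem_erase, mem_range] at hm
    rw [hY m (by omega), sub_ne_zero]
    exact_mod_cast hm.1
  rintro ⟨G, hG⟩
  have := congrArg (eval x) hG
  rw [map_areaForm, map_mul, map_splitSum] at this
  simp only [eval_X, edgeSum, map_add] at this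
  rw [ht, hY _ (by omega)] at this
  exact hP (by rw [this]; push_cast; ring)

/-- The substitution which eliminates the difference of the last two triangles. -/
noncomputable def paramHom (n : ℕ) :
    MvPolynomial (Fin (n + 1) ⊕ Fin n) ℂ →ₐ[ℂ] MvPolynomial (Triangle n) ℂ :=
  aeval (Sum.elim edgeSum fun i => X (Sum.inl i.castSucc) - X (Sum.inr i.castSucc))

theorem paramHom_inl (i : Fin (n + 1)) : paramHom n (X (Sum.inl i)) = edgeSum i := by
  simp [paramHom]

theorem paramHom_inr (i : Fin n) : paramHom n (X (Sum.inr i)) =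
    X (Sum.inl i.castSucc) - X (Sum.inr i.castSucc) := by
  simp [paramHom]

theorem paramHom_splitSum (m : ℕ) :
    paramHom n (splitSum (fun i => X (Sum.inl i)) m) = splitSum edgeSum m := by
  have := map_splitSum (paramHom n).toRingHom (fun i => X (Sum.inl i)) m
  simpa only [AlgHom.toRingHom_eq_coe, RingHom.coe_coe, paramHom_inl] using this

/-- The coefficient, up to sign, of the difference of the last two triangles in the area form. -/
noncomputable def leadFactor (n : ℕ) : MvPolynomial (Triangle n) ℂ :=
  ∏ j ∈ Ico 1 n, splitSum (edgeSum (n := n)) j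

theorem exists_paramHom_eq_leadFactor (n : ℕ) : ∃ a, paramHom n a = leadFactor n :=
  ⟨∏ j ∈ Ico 1 n, splitSum (fun i => X (Sum.inl i)) j, by
    rw [map_prod, leadFactor, prod_congr rfl fun j _ => paramHom_splitSum j]⟩

/-- Modulo the area form and up to powers of the leading factor, `F` does not involve the
difference of the last two triangles. -/
def IsReducible (F : MvPolynomial (Triangle n) ℂ) : Prop :=
  ∃ k g, areaForm X ∣ leadFactor n ^ k * F - paramHom n g

theorem isReducible_paramHom (g) : IsReducible (paramHom n g) :=
  ⟨0, g, by simp⟩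

theorem IsReducible.add {F G : MvPolynomial (Triangle n) ℂ} (hF : IsReducible F)
    (hG : IsReducible G) : IsReducible (F + G) := by
  obtain ⟨a, ha⟩ := exists_paramHom_eq_leadFactor n
  obtain ⟨k, f, hf⟩ := hF
  obtain ⟨l, g, hg⟩ := hG
  refine ⟨k + l, a ^ l * f + a ^ k * g, ?_⟩
  convert! (hf.mul_left (leadFactor n ^ l)).add (hg.mul_left (leadFactor n ^ k)) using 1
  simp only [map_add, map_mul, map_pow, ha]
  ring

theorem IsReducible.mul {F G : MvPolynomial (Triangle n) ℂ} (hF : IsReducible F)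
    (hG : IsReducible G) : IsReducible (F * G) := by
  obtain ⟨k, f, hf⟩ := hF
  obtain ⟨l, g, hg⟩ := hG
  refine ⟨k + l, f * g, ?_⟩
  convert! (hf.mul_right (leadFactor n ^ l * G)).add (hg.mul_left (paramHom n f)) using 1
  simp only [map_mul]
  ring

theorem isReducible_C (c : ℂ) : IsReducible (C c : MvPolynomial (Triangle n) ℂ) := by
  have := isReducible_paramHom (n := n) (C c)
  rwa [paramHom, algHom_C] at this

/-- Only the last difference needs an argument: the form is linear in it with coefficient
`-leadFactor n`, so one power of `leadFactor n` suffices to eliminate it. -/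
theorem isReducible_sub (i : Fin (n + 1)) :
    IsReducible (X (Sum.inl i) - X (Sum.inr i) : MvPolynomial (Triangle n) ℂ) := by
  induction i using Fin.lastCases with
  | cast i =>
    rw [← paramHom_inr]
    exact isReducible_paramHom _
  | last =>
    refine ⟨1, ∑ i : Fin n, X (Sum.inr i) *
      cofactor n (splitSum fun k : Fin (n + 1) => X (Sum.inl k)) i, ?_⟩
    have h : paramHom n (∑ i : Fin n, X (Sum.inr i) *
        cofactor n (splitSum fun k : Fin (n + 1) => X (Sum.inl k)) i) =
        ∑ i : Fin n, (X (Sum.inl i.castSucc) - X (Sum.inr i.castSucc)) *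
          cofactor n (splitSum edgeSum) i := by
      rw [map_sum]
      refine sum_congr rfl fun i _ => ?_
      have := map_cofactor (n := n) (paramHom n).toRingHom
        (splitSum fun k : Fin (n + 1) => X (Sum.inl k)) i
      simp only [AlgHom.toRingHom_eq_coe, RingHom.coe_coe, paramHom_splitSum] at this
      rw [map_mul, paramHom_inr, this]
    rw [h]
    refine ⟨-1, ?_⟩
    rw [areaForm, Fin.sum_univ_castSucc]
    simp only [Fin.val_castSucc, Fin.val_last]
    have hc : cofactor n (splitSum fun k : Fin (n + 1) =>
        (X (Sum.inl k) + X (Sum.inr k) : MvPolynomial (Triangle n) ℂ)) n = -leadFactor n := by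
      rw [cofactor, if_pos rfl]; rfl
    rw [hc]
    change _ = (∑ i : Fin n, (X (Sum.inl i.castSucc) - X (Sum.inr i.castSucc)) *
          cofactor n (splitSum edgeSum) i + _) * _
    ring

/-- Reducible polynomials are closed under sums and products, and each variable is half of a sum
plus or minus a difference. -/
theorem isReducible (F : MvPolynomial (Triangle n) ℂ) : IsReducible F := by
  induction F using MvPolynomial.induction_on with
  | C c => exact isReducible_C c
  | add F G hF hG => exact hF.add hG
  | mul_X F j hF =>
    refine hF.mul ?_
    have ht : ∀ i, IsReducible (X (Sum.inl i) + X (Sum.inr i) : MvPolynomial (Triangle n) ℂ) := by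
      intro i
      have := isReducible_paramHom (n := n) (X (Sum.inl i))
      rwa [paramHom_inl] at this
    have h2 : (C (1 / 2) * 2 : MvPolynomial (Triangle n) ℂ) = 1 := by
      rw [← map_ofNat C 2, ← C_mul]
      simp
    have hneg : (C (-1) : MvPolynomial (Triangle n) ℂ) = -1 := by simp
    rcases j with i | i
    · convert! (isReducible_C (1 / 2)).mul ((ht i).add (isReducible_sub i)) using 1
      linear_combination (-X (Sum.inl i)) * h2
    · convert! (isReducible_C (1 / 2)).mul
        ((ht i).add ((isReducible_C (-1)).mul (isReducible_sub i))) using 1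
      rw [hneg]
      linear_combination (-X (Sum.inr i)) * h2

theorem isRelPrime_areaForm_leadFactor_pow (k : ℕ) :
    IsRelPrime (areaForm X) (leadFactor n ^ k) := by
  refine IsRelPrime.pow_right (IsRelPrime.prod_right fun j hj => IsRelPrime.symm ?_)
  rw [mem_Ico] at hj
  obtain ⟨i, rfl⟩ := Nat.exists_eq_add_of_le' hj.1
  exact (irreducible_splitSum _).isRelPrime_iff_not_dvd.2 (not_splitSum_dvd i hj.2)

/-- A polynomial which vanishes on the areas of all drawings is divisible by the area form. -/
theorem areaForm_dvd_of_eval_areas (hn : 1 ≤ n) (F : MvPolynomial (Triangle n) ℂ)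
    (hF : ∀ ρ ∈ (triangulation n).drawingSpace, (triangulation n).areas ρ ≠ 0 →
      eval ((triangulation n).areas ρ) F = 0) : areaForm X ∣ F := by
  obtain ⟨ρ₀, hρ₀⟩ := exists_isGeneric n
  obtain ⟨k, g, hg⟩ := isReducible F
  -- Where `D` is non-zero, the parameters come from a drawing, at which `F` and the form vanish,
  -- hence so does `g`. Thus `g * D` vanishes everywhere.
  let D : MvPolynomial (Fin (n + 1) ⊕ Fin n) ℂ :=
    ∏ j ∈ range (n + 1), splitSum (fun i => X (Sum.inl i)) j
  have hD : ∀ x, eval x D = ∏ j ∈ range (n + 1), splitSum (fun i => x (Sum.inl i)) j := by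
    intro x
    simp [D, map_splitSum]
  have hD0 : D ≠ 0 := by
    intro h
    have := hD (Sum.elim (Pi.single 0 1) 0)
    rw [h, map_zero] at this
    exact prod_ne_zero_iff.2 (fun j _ => splitSum_single_ne_zero j) this.symm
  have hgD : g * D = 0 := by
    refine MvPolynomial.funext fun x => ?_
    rw [map_mul, map_zero, mul_eq_zero, or_iff_not_imp_right, hD]
    intro hx
    have hx' := prod_ne_zero_iff.1 hx
    obtain ⟨ρ, hρ, ht, hδ⟩ := exists_drawing (fun i => x (Sum.inl i)) (fun i => x (Sum.inr i))
      fun j hj => hx' j (by simpa [Nat.lt_succ_iff] using hj)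
    have hρ' : ρ ∈ (triangulation n).drawingSpace := by
      rw [(triangulation n).drawingSpace_eq hρ₀]; exact hρ
    -- `splitSum t 0` is minus the total area.
    have h0 : (triangulation n).areas ρ ≠ 0 := by
      intro h
      apply hx' 0 (by simp)
      simp only [← ht, h]
      simp [splitSum]
    have hev : eval ((triangulation n).areas ρ) (paramHom n g) = eval x g := by
      have : (eval ((triangulation n).areas ρ)).comp (paramHom n).toRingHom = eval x := by
        refine MvPolynomial.ringHom_ext (fun c => by simp) ?_
        rintro (i | i)
        · simpa [paramHom_inl, edgeSum] using ht i
        · simpa [paramHom_inr] using hδ i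
      exact congrArg (fun φ : _ →+* ℂ => φ g) this
    obtain ⟨Q, hQ⟩ := hg
    have := congrArg (eval ((triangulation n).areas ρ)) hQ
    rw [map_sub, map_mul, map_mul, hF ρ hρ' h0, map_areaForm, hev] at this
    simp only [eval_X, areaForm_areas_of_mem_drawingSpace hn hρ'] at this
    simpa using this
  rw [(mul_eq_zero.1 hgD).resolve_right hD0, map_zero, sub_zero] at hg
  exact (isRelPrime_areaForm_leadFactor_pow k).dvd_of_dvd_mul_left hg

end Diagonal

/-! ### The area variety and its area polynomials -/

namespace SquareTriangulation

open MvPolynomial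

variable {V ι : Type} [Fintype V] [Fintype ι] (T : SquareTriangulation V ι)

/-- Passing to the Zariski closure imposes no new condition on homogeneous polynomials, and
homogeneity makes the representative irrelevant. -/
theorem eval_areaVariety_iff_eval_areas {d : ℕ} {F : MvPolynomial ι ℂ} (hF : F.IsHomogeneous d) :
    (∀ x ∈ T.areaVariety, eval x.rep F = 0) ↔
      ∀ ρ ∈ T.drawingSpace, T.areas ρ ≠ 0 → eval (T.areas ρ) F = 0 := by
  constructor
  · intro h ρ hρ h0
    rw [← hF.eval_rep_mk_eq_zero_iff _ h0]
    exact h _ fun e G _ hG => hG _ ⟨ρ, hρ, h0, rfl⟩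
  · intro h x hx
    refine hx d F hF ?_
    rintro y ⟨ρ, hρ, h0, rfl⟩
    exact (hF.eval_rep_mk_eq_zero_iff _ h0).2 (h ρ hρ h0)

end SquareTriangulation

namespace Diagonal

open Finset MvPolynomial

variable {n : ℕ}

theorem eval_areaVariety_iff (hn : 1 ≤ n) {d : ℕ} {F : MvPolynomial (Triangle n) ℂ}
    (hF : F.IsHomogeneous d) :
    (∀ x ∈ (triangulation n).areaVariety, eval x.rep F = 0) ↔
      map (Int.castRingHom ℂ) (areaPoly n) ∣ F := by
  rw [SquareTriangulation.eval_areaVariety_iff_eval_areas _ hF]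
  constructor
  · intro h
    rw [map_areaPoly]
    exact areaForm_dvd_of_eval_areas hn F h
  · rintro ⟨G, rfl⟩ ρ hρ -
    rw [map_mul, eval_map_areaPoly, areaForm_areas_of_mem_drawingSpace hn hρ, zero_mul]

theorem areaPoly_isUnit_of_C_dvd (hn : 1 ≤ n) {c : ℤ} (hc : C c ∣ areaPoly n) : IsUnit c := by
  obtain ⟨G, hG⟩ := hc
  have := congrArg (eval₂Hom (RingHom.id ℤ) (Pi.single (Sum.inl 0) 1)) hG
  rw [eval₂_areaPoly, areaForm_single hn, map_mul, eval₂Hom_C] at this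
  exact IsUnit.of_mul_eq_one _ this.symm

theorem isAreaPolynomial_areaPoly (hn : 1 ≤ n) :
    (triangulation n).IsAreaPolynomial (areaPoly n) :=
  ⟨⟨n, isHomogeneous_areaPoly hn⟩, fun _ => areaPoly_isUnit_of_C_dvd hn,
    fun _ _ hF => eval_areaVariety_iff hn hF⟩

/-- Two area polynomials divide each other over `ℂ`, so they differ by a constant. It is an integer
because `areaPoly n` has value `1` at an integral point, and primitivity of `p` makes it `±1`. -/
theorem isAreaPolynomial_iff (hn : 1 ≤ n) (p : MvPolynomial (Triangle n) ℤ) :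
    (triangulation n).IsAreaPolynomial p ↔ p = areaPoly n ∨ p = -areaPoly n := by
  have hinj : Function.Injective (Int.castRingHom ℂ) := Int.cast_injective
  constructor
  · rintro ⟨⟨d, hd⟩, hp, hV⟩
    have h1 : map (Int.castRingHom ℂ) p ∣ map (Int.castRingHom ℂ) (areaPoly n) :=
      (hV n _ ((isHomogeneous_areaPoly hn).map _)).1
        ((eval_areaVariety_iff hn ((isHomogeneous_areaPoly hn).map _)).2 dvd_rfl)
    have h2 : map (Int.castRingHom ℂ) (areaPoly n) ∣ map (Int.castRingHom ℂ) p :=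
      (eval_areaVariety_iff hn (hd.map _)).1 ((hV d _ (hd.map _)).2 dvd_rfl)
    obtain ⟨u, hu⟩ := associated_of_dvd_dvd h2 h1
    obtain ⟨c, -, hc⟩ := isUnit_iff_eq_C_of_isReduced.1 u.isUnit
    rw [hc] at hu
    obtain ⟨m, hcm⟩ : ∃ m : ℤ, (m : ℂ) = c := by
      refine ⟨eval (fun j : Triangle n => if j = Sum.inl 0 then 1 else 0) p, ?_⟩
      have h3 : (Int.castRingHom ℂ).comp (eval fun j : Triangle n => if j = Sum.inl 0 then 1 else 0) =
          (eval (Pi.single (Sum.inl 0) 1)).comp (map (Int.castRingHom ℂ)) :=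
        MvPolynomial.ringHom_ext (by simp) (fun j => by simp [Pi.single_apply])
      have h4 := congrArg (fun φ : MvPolynomial (Triangle n) ℤ →+* ℂ => φ p) h3
      simp only [RingHom.comp_apply, eq_intCast] at h4
      rw [h4, ← hu, map_mul, eval_map_areaPoly, areaForm_single hn, one_mul, eval_C]
    have hpm : p = areaPoly n * C m := by
      apply map_injective _ hinj
      rw [← hu, map_mul, map_C, ← hcm]
      rfl
    rcases Int.isUnit_iff.1 (hp m (hpm ▸ dvd_mul_left _ _)) with rfl | rfl
    · left; simpa using hpm
    · right; simpa using hpm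
  · rintro (rfl | rfl)
    · exact isAreaPolynomial_areaPoly hn
    · obtain ⟨⟨d, hd⟩, hp, hV⟩ := isAreaPolynomial_areaPoly hn
      refine ⟨⟨d, hd.neg⟩, fun c hc => hp c ((dvd_neg).1 hc), fun d F hF => ?_⟩
      rw [hV d F hF, map_neg, neg_dvd]

theorem areaPoly_ne_zero (hn : 1 ≤ n) : areaPoly n ≠ 0 := fun h =>
  not_isUnit_zero (areaPoly_isUnit_of_C_dvd hn (c := 0) (by rw [h, C_0]))

theorem totalDegree_areaPoly (hn : 1 ≤ n) : (areaPoly n).totalDegree = n :=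
  (isHomogeneous_areaPoly hn).totalDegree (areaPoly_ne_zero hn)

theorem isHyper (hn : 1 ≤ n) : (triangulation n).IsHyper := by
  have hinj : Function.Injective (Int.castRingHom ℂ) := Int.cast_injective
  have hhom := (isHomogeneous_areaPoly hn).map (Int.castRingHom ℂ)
  refine ⟨exists_isGeneric n, n, map (Int.castRingHom ℂ) (areaPoly n), hn,
    (map_ne_zero_iff _ (map_injective _ hinj)).2 (areaPoly_ne_zero hn), hhom, ?_⟩
  refine Set.Subset.antisymm (fun x hx => (eval_areaVariety_iff hn hhom).2 dvd_rfl x hx) ?_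
  intro x hx d F hF h
  have : ∀ x ∈ (triangulation n).areaVariety, eval x.rep F = 0 := fun x hx => hx d F hF h
  obtain ⟨G, rfl⟩ := (eval_areaVariety_iff hn hF).1 this
  rw [map_mul, show eval x.rep (map (Int.castRingHom ℂ) (areaPoly n)) = 0 from hx, zero_mul]

/-! ### Canonical Monsky polynomials -/

/-- The area polynomial vanishes at the areas of the generic drawing over the function field. -/
theorem aeval_areas_genericPoint (hn : 1 ≤ n) :
    aeval ((triangulation n).areas (triangulation n).genericPoint) (areaPoly n) = 0 := by
  have h := eval₂_areaPoly (algebraMap ℤ (triangulation n).CoordField)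
    ((triangulation n).areas (triangulation n).genericPoint)
  rw [coe_eval₂Hom, ← aeval_def] at h
  rw [h]
  refine areaForm_areas hn _ ?_ ?_
  · have h0 : v n 0 ≠ (triangulation n).corner 2 := by simp [Fin.ext_iff]
    have h1 : q n ≠ (triangulation n).corner 2 := by simp
    have h3 : s n ≠ (triangulation n).corner 2 := by simp
    have h2 : ¬ v n (Fin.last (n + 1)) ≠ (triangulation n).corner 2 := by simp
    rw [SquareTriangulation.genericPoint, SquareTriangulation.genericPoint,
      SquareTriangulation.genericPoint, SquareTriangulation.genericPoint, dif_pos h0, dif_pos h1,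
      dif_pos h3, dif_neg h2]
    simp
  · have h1 : q n ≠ (triangulation n).corner 2 := by simp
    have h3 : s n ≠ (triangulation n).corner 2 := by simp
    rw [SquareTriangulation.genericPoint, SquareTriangulation.genericPoint, dif_pos h1, dif_pos h3]
    intro h
    have := congrArg Prod.fst h
    simp only [SquareTriangulation.freePoint] at this
    have := IsFractionRing.injective _ _ this
    have := X_injective this
    simpa using congrArg (fun w => w.1.1) this

theorem isMonskyPolynomial_of_two_mul_eq (hn : 1 ≤ n) {f p : MvPolynomial (Triangle n) ℤ}
    (hf : 2 * f = sigmaPoly (Triangle n) ^ n + p) (hp : p = areaPoly n ∨ p = -areaPoly n) :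
    (triangulation n).IsMonskyPolynomial f := by
  have hhom : p.IsHomogeneous n := by
    rcases hp with rfl | rfl
    exacts [isHomogeneous_areaPoly hn, (isHomogeneous_areaPoly hn).neg]
  have h0 : aeval ((triangulation n).areas (triangulation n).genericPoint) p = 0 := by
    rcases hp with rfl | rfl
    · exact aeval_areas_genericPoint hn
    · rw [map_neg, aeval_areas_genericPoint hn, neg_zero]
  refine ⟨⟨n, isHomogeneous_of_two_mul (hf ▸ (isHomogeneous_sigmaPoly_pow n).add hhom)⟩, n, ?_⟩
  have := congrArg (aeval ((triangulation n).areas (triangulation n).genericPoint)) hf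
  rw [map_mul, map_add, h0, add_zero, map_pow, sigmaPoly, map_sum] at this
  simpa using this

theorem isPositivePoly_of_two_mul_eq (hn : 1 ≤ n) {f p : MvPolynomial (Triangle n) ℤ}
    (hf : 2 * f = sigmaPoly (Triangle n) ^ n + p) (hp : p = areaPoly n ∨ p = -areaPoly n) :
    IsPositivePoly f := by
  intro m
  have hd : IsDominated p (sigmaPoly (Triangle n) ^ n) := by
    rcases hp with rfl | rfl
    exacts [isDominated_areaPoly hn, (isDominated_areaPoly hn).neg]
  have h1 := congrArg (coeff m) hf
  rw [coeff_two_mul, coeff_add] at h1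
  have h2 := (abs_le.1 (hd m)).1
  linarith

end Diagonal

theorem mainTheorem8 (n : ℕ) (hn : 1 ≤ n) :
    (Diagonal.triangulation n).IsHyper ∧
    (∃ p, ∀ p', (Diagonal.triangulation n).IsAreaPolynomial p' ↔ p' = p ∨ p' = -p) ∧
    ∀ p, (Diagonal.triangulation n).IsAreaPolynomial p →
      IsSmallPoly p ∧
      ∃ f f' : MvPolynomial (Diagonal.Triangle n) ℤ,
        2 * f = sigmaPoly (Diagonal.Triangle n) ^ p.totalDegree + p ∧
        2 * f' = sigmaPoly (Diagonal.Triangle n) ^ p.totalDegree - p ∧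
        (Diagonal.triangulation n).IsMonskyPolynomial f ∧
        (Diagonal.triangulation n).IsMonskyPolynomial f' ∧
        IsPositivePoly f ∧ IsPositivePoly f' := by
  refine ⟨Diagonal.isHyper hn, ⟨_, Diagonal.isAreaPolynomial_iff hn⟩, fun p hp => ?_⟩
  rw [Diagonal.isAreaPolynomial_iff hn] at hp
  obtain ⟨g, hg⟩ := Diagonal.exists_two_mul_eq hn
  -- One congruence modulo 2 serves both signs, since the two numerators differ by `2 * areaPoly n`.
  have hg' : 2 * (g - Diagonal.areaPoly n) =
      sigmaPoly (Diagonal.Triangle n) ^ n + -Diagonal.areaPoly n := by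
    linear_combination hg
  have hneg : -p = Diagonal.areaPoly n ∨ -p = -Diagonal.areaPoly n := by
    rcases hp with rfl | rfl <;> simp
  have hdeg : p.totalDegree = n := by
    rcases hp with rfl | rfl <;> simp [Diagonal.totalDegree_areaPoly hn]
  have hsmall : IsSmallPoly p := by
    rcases hp with rfl | rfl
    · exact Diagonal.isSmallPoly_areaPoly hn
    · obtain ⟨⟨d, hd⟩, h⟩ := Diagonal.isSmallPoly_areaPoly hn
      exact ⟨⟨d, hd.neg⟩, fun m => by simpa using h m⟩
  obtain ⟨f, f', hf, hf'⟩ : ∃ f f' : MvPolynomial (Diagonal.Triangle n) ℤ,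
      2 * f = sigmaPoly (Diagonal.Triangle n) ^ n + p ∧
      2 * f' = sigmaPoly (Diagonal.Triangle n) ^ n + -p := by
    rcases hp with rfl | rfl
    · exact ⟨_, _, hg, hg'⟩
    · exact ⟨_, _, hg', by rwa [neg_neg]⟩
  rw [hdeg]
  exact ⟨hsmall, f, f', hf, by rw [hf', sub_eq_add_neg],
    Diagonal.isMonskyPolynomial_of_two_mul_eq hn hf hp,
    Diagonal.isMonskyPolynomial_of_two_mul_eq hn hf' hneg,
    Diagonal.isPositivePoly_of_two_mul_eq hn hf hp,
    Diagonal.isPositivePoly_of_two_mul_eq hn hf' hneg⟩
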